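/- \begin{theorem}\label{thm:main_spend_rate_theorem_cp} \textbf{Setting.} A campaign with budget $B\ge 0$ consists of $T=E\tau$ rounds, divided into $E\ge1$ consecutive episodes of $\tau\ge 1$ rounds each. All rounds are independent. In every round the price is the same constant $p\ge 0$, and in a round of episode $e$ the value $v$ is drawn from a probability distribution $F_e$ on $[0,h]$ that has no atom in $[p,\infty)$ (for example, $F_e$ has a density). The expected spend per round of episode $e$ under the multiplier $\mu$ is $$G_e(\mu)=\mathbb E_{v\sim F_e}\big[\mathbf 1\{v\ge(1+\mu)p\}\,p\big].$$ Let $\mu^\star\ge0$ be any minimizer over $\mu\ge 0$ of the expected dual $\Psi(\mu)=\mathbb E\big[\sum_{t=1}^T (v_t-(1+\mu)p)^+ +\mu B\big]$. The optimal spend rates are $\rho_e=G_e(\mu^\star)$. \textbf{Algorithm.} For each episode $e$ draw $n\ge1$ i.i.d.\ values $V_{e,1},\dots,V_{e,n}\sim F_e$, independently over episodes. $\mathsf{ApproxSpendFP}$ computes the empirical distribution function $\widehat F_e(x)=\frac1n\sum_{i=1}^n\mathbf 1\{V_{e,i}<x\}$ and returns $\widehat G_e(\mu)=p\,\big(1-\widehat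 F_e((1+\mu)p)\big)$. $\mathsf{ApproxSpendRate}$ (with $\mathsf{ApproxSpendFP}$ as its spend estimator) sets $\widehat G(\mu)=\frac1E\sum_{e=1}^E\widehat G_e(\mu)$ and $\widehat\mu=\inf\{\mu\ge0:\widehat G(\mu)\le B/T\}$, and returns $\widehat\rho_e=\widehat G_e(\widehat\mu)$ for $e=1,\dots,E$. \textbf{Claim.} For every $\delta\in(0,1)$, with probability at least $1-\delta$ over the samples, simultaneously for every episode $e$, $$|\widehat\rho_e-\rho_e|\le (E+1)\,p\,\sqrt{\frac{\log(2E/\delta)}{2n}}.$$ \end{theorem} -/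

import Mathlib

open MeasureTheory

noncomputable section

namespace AdPacing

/-- Joint law of the `(value, price)` pairs of the `T = E * τ` rounds of an episodic campaign:
the rounds are independent, and a round of episode `e` has law `Q_e = F_e × D_e`. Round `t`
(counted from `0`) lies in episode `t.divNat = ⌊t / τ⌋`, so every episode has `τ` consecutive
rounds. -/
def campaignLaw {E : ℕ} (F D : Fin E → Measure ℝ) (τ : ℕ) :
    Measure (Fin (E * τ) → ℝ × ℝ) :=
  Measure.pi fun t => (F t.divNat).prod (D t.divNat)

/-- Episodic spend function `G_e(μ) = 𝔼_{v ∼ F, p ∼ D} [1{v ≥ (1 + μ) p} p]`. -/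
def spendFn (F D : Measure ℝ) (μ : ℝ) : ℝ :=
  ∫ z : ℝ × ℝ, (if (1 + μ) * z.2 ≤ z.1 then z.2 else 0) ∂(F.prod D)

/-- Expected dual `Ψ(μ) = 𝔼 [∑_t (v_t - (1 + μ) p_t)⁺ + μ B]` of the hindsight problem. -/
def dual {E : ℕ} (B : ℝ) (F D : Fin E → Measure ℝ) (τ : ℕ) (μ : ℝ) : ℝ :=
  ∫ w, ((∑ t, max ((w t).1 - (1 + μ) * (w t).2) 0) + μ * B) ∂(campaignLaw F D τ)

/-- `μ ≥ 0` minimizes the expected dual over `[0, ∞)`. -/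
def IsDualMinimizer {E : ℕ} (B : ℝ) (F D : Fin E → Measure ℝ) (τ : ℕ) (μ : ℝ) : Prop :=
  0 ≤ μ ∧ IsMinOn (dual B F D τ) (Set.Ici 0) μ

/-- `ρ` is the vector of optimal spend rates: `ρ_e = G_e(μ⋆)` for a dual minimizer `μ⋆`. -/
def IsOptimalSpendRates {E : ℕ} (B : ℝ) (F D : Fin E → Measure ℝ) (τ : ℕ)
    (ρ : Fin E → ℝ) : Prop :=
  ∃ μ, IsDualMinimizer B F D τ μ ∧ ∀ e, ρ e = spendFn (F e) (D e) μ

/-- Empirical distribution function `F̂(x) = (1/n) ∑_i 1{V_i < x}`. -/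
def empiricalCDF {n : ℕ} (V : Fin n → ℝ) (x : ℝ) : ℝ :=
  (1 / (n : ℝ)) * ∑ i, if V i < x then 1 else 0

/-- The estimate `Ĝ(μ) = p (1 - F̂((1 + μ) p))` of an episodic spend function, for the constant
price `p` and the value samples `V`. -/
def approxSpendFP {n : ℕ} (V : Fin n → ℝ) (p : ℝ) (μ : ℝ) : ℝ :=
  p * (1 - empiricalCDF V ((1 + μ) * p))

/-- The average `Ĝ(μ) = (1/E) ∑_e Ĝ_e(μ)` of the estimated episodic spend functions. -/
def avgSpend {E : ℕ} (G : Fin E → ℝ → ℝ) (μ : ℝ) : ℝ :=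
  (1 / (E : ℝ)) * ∑ e, G e μ

/-- The least multiplier `μ ≥ 0` whose estimated average spend is at most `B / T`. It is taken as an
infimum: an estimate built from `empiricalCDF` is left-continuous in `μ`, so that a minimum need
not be attained. -/
def approxMultiplier {E : ℕ} (B : ℝ) (T : ℕ) (G : Fin E → ℝ → ℝ) : ℝ :=
  sInf {μ : ℝ | 0 ≤ μ ∧ avgSpend G μ ≤ B / (T : ℝ)}

/-- The spend rates `ρ̂_e = Ĝ_e(μ̂)` computed from estimated episodic spend functions `Ĝ_e`. -/
def approxSpendRate {E : ℕ} (B : ℝ) (T : ℕ) (G : Fin E → ℝ → ℝ) (e : Fin E) : ℝ :=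
  G e (approxMultiplier B T G)

/-- Law of the historical data: independently over episodes, `n` i.i.d. values from each `F_e`. -/
def sampleLaw {E : ℕ} (F : Fin E → Measure ℝ) (n : ℕ) : Measure (Fin E → Fin n → ℝ) :=
  Measure.pi fun e => Measure.pi fun _ => F e

end AdPacing

end

/-! Accuracy of the estimates is needed only at the deterministic multiplier `μ⋆`, so Hoeffding and
a union bound over episodes give error `p * ε` there with probability `1 - δ`; no bound uniform in
`μ` is required.

The transfer from `μ⋆` to `μ̂` rests on monotonicity: all `Ĝ_e(μ̂) - Ĝ_e(μ⋆)` have the same sign, so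
a bound on the total bounds each term. Both totals are pinned near the budget. For the true spends
this is complementary slackness of the dual (`IsDualMinimizer.sum_spendFn`). For the estimates, left
continuity and the almost sure absence of ties put the total at `μ̂` within `p / n` of the per-round
budget sum `E * (B / T)`, from above only if `μ̂ = 0` is excluded from the lower bound.
`abs_approxSpendRate_sub_le` combines these: `E - 1` errors from the other episodes plus the jump `p
/ n ≤ 2 * p * ε` give the factor `E + 1`. -/

namespace AdPacing

open Filter Topology ProbabilityTheory

/-! ### Sample-wise analysis: monotonicity, jumps and transfer of accuracy. -/

section Deterministic

lemma approxSpendFP_eq {n : ℕ} (hn : 0 < n) (V : Fin n → ℝ) (p μ : ℝ) :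
    approxSpendFP V p μ = p / n * ∑ i, if (1 + μ) * p ≤ V i then (1 : ℝ) else 0 := by
  have hn' : (n : ℝ) ≠ 0 := by positivity
  have h : ∀ i, (if (1 + μ) * p ≤ V i then (1 : ℝ) else 0)
      = 1 - if V i < (1 + μ) * p then 1 else 0 := by
    intro i
    by_cases hi : V i < (1 + μ) * p
    · simp [hi, not_le.2 hi]
    · simp [hi, not_lt.1 hi]
  simp only [h, Finset.sum_sub_distrib, approxSpendFP, empiricalCDF]
  simp
  field_simp

lemma antitone_approxSpendFP {n : ℕ} (hn : 0 < n) (V : Fin n → ℝ) {p : ℝ} (hp : 0 ≤ p) :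
    Antitone (approxSpendFP V p) := by
  intro a b hab
  rw [approxSpendFP_eq hn, approxSpendFP_eq hn]
  have : (1 + a) * p ≤ (1 + b) * p := by gcongr
  refine mul_le_mul_of_nonneg_left (Finset.sum_le_sum fun i _ => ?_) (by positivity)
  split_ifs with h1 h2
  · norm_num
  · exact absurd (this.trans h1) h2
  · norm_num
  · norm_num

lemma sum_approxSpendFP_eq {E n : ℕ} (hn : 0 < n) (V : Fin E → Fin n → ℝ) (p μ : ℝ) :
    ∑ e, approxSpendFP (V e) p μ
      = p / n * ∑ x : Fin E × Fin n, if (1 + μ) * p ≤ V x.1 x.2 then (1 : ℝ) else 0 := by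
  simp only [approxSpendFP_eq hn, Fintype.sum_prod_type, Finset.mul_sum]

lemma avgSpend_le_iff {E : ℕ} (hE : 0 < E) (G : Fin E → ℝ → ℝ) (μ c : ℝ) :
    avgSpend G μ ≤ c ↔ ∑ e, G e μ ≤ E * c := by
  have hE' : (0 : ℝ) < E := by exact_mod_cast hE
  rw [avgSpend, one_div, inv_mul_le_iff₀ hE']

lemma approxMultiplier_nonneg {E : ℕ} (B : ℝ) (T : ℕ) (G : Fin E → ℝ → ℝ) :
    0 ≤ approxMultiplier B T G :=
  Real.sInf_nonneg fun _ hx => hx.1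

lemma sum_le_of_approxMultiplier_lt {E n T : ℕ} (hE : 0 < E) (hn : 0 < n) {B p : ℝ} (hB : 0 ≤ B)
    (hp : 0 < p) (V : Fin E → Fin n → ℝ) {μ : ℝ}
    (hμ : approxMultiplier B T (fun e => approxSpendFP (V e) p) < μ) :
    ∑ e, approxSpendFP (V e) p μ ≤ E * (B / T) := by
  have hne : {μ : ℝ | 0 ≤ μ ∧
      avgSpend (fun e => approxSpendFP (V e) p) μ ≤ B / (T : ℝ)}.Nonempty := by
    -- Once the threshold passes every sample the estimated spend is zero, so the infimum is over a
    -- nonempty set and is not the default `sInf ∅ = 0`.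
    have hev : ∀ᶠ μ : ℝ in atTop, 0 ≤ μ ∧ ∀ x : Fin E × Fin n, V x.1 x.2 < (1 + μ) * p := by
      refine (eventually_ge_atTop 0).and (eventually_all.2 fun x => ?_)
      exact ((tendsto_atTop_add_const_left _ 1 tendsto_id).atTop_mul_const hp).eventually_gt_atTop _
    obtain ⟨μ, h0, h⟩ := hev.exists
    refine ⟨μ, h0, ?_⟩
    rw [avgSpend_le_iff hE, sum_approxSpendFP_eq hn]
    simp only [not_le.2 (h _), if_false, Finset.sum_const_zero, mul_zero]
    positivity
  obtain ⟨a, ha, haμ⟩ := exists_lt_of_csInf_lt hne hμ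
  refine le_trans ?_ ((avgSpend_le_iff hE _ _ _).1 ha.2)
  exact Finset.sum_le_sum fun e _ => antitone_approxSpendFP hn _ hp.le haμ.le

lemma lt_sum_of_lt_approxMultiplier {E n T : ℕ} (hE : 0 < E) {B p : ℝ}
    (V : Fin E → Fin n → ℝ) {μ : ℝ} (h0 : 0 ≤ μ)
    (hμ : μ < approxMultiplier B T (fun e => approxSpendFP (V e) p)) :
    E * (B / T) < ∑ e, approxSpendFP (V e) p μ := by
  by_contra! h
  refine (notMem_of_lt_csInf hμ ⟨0, fun _ hx => hx.1⟩) ⟨h0, ?_⟩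
  rwa [avgSpend_le_iff hE]

lemma tendsto_threshold (p μ : ℝ) : Tendsto (fun m : ℝ => (1 + m) * p) (𝓝 μ) (𝓝 ((1 + μ) * p)) :=
  (Continuous.tendsto (by fun_prop) μ)

/-- Left continuity of the estimated spend: at a positive estimated multiplier the budget is
exhausted. -/
lemma le_sum_approxMultiplier {E n T : ℕ} (hE : 0 < E) (hn : 0 < n) {B p : ℝ}
    (hp : 0 < p) (V : Fin E → Fin n → ℝ)
    (hμ : 0 < approxMultiplier B T (fun e => approxSpendFP (V e) p)) :
    E * (B / T) ≤
      ∑ e, approxSpendFP (V e) p (approxMultiplier B T (fun e => approxSpendFP (V e) p)) := by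
  set m := approxMultiplier B T (fun e => approxSpendFP (V e) p) with hm
  -- Just left of `m`, samples strictly below the threshold stay below it, so no new sample is
  -- counted.
  have hev : ∀ᶠ μ in 𝓝[<] m, (∀ x : Fin E × Fin n, V x.1 x.2 < (1 + m) * p →
      V x.1 x.2 < (1 + μ) * p) ∧ 0 < μ ∧ μ < m := by
    refine (eventually_all.2 fun x => ?_).and
      (((lt_mem_nhds hμ).filter_mono nhdsWithin_le_nhds).and self_mem_nhdsWithin)
    by_cases hx : V x.1 x.2 < (1 + m) * p
    · filter_upwards [nhdsWithin_le_nhds ((tendsto_threshold p m).eventually_const_lt hx)]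
        with μ h _ using h
    · exact Eventually.of_forall fun μ h => absurd h hx
  obtain ⟨μ, hV, h0, hlt⟩ := hev.exists
  refine (lt_sum_of_lt_approxMultiplier hE V h0.le (hm ▸ hlt)).le.trans ?_
  rw [sum_approxSpendFP_eq hn, sum_approxSpendFP_eq hn]
  refine mul_le_mul_of_nonneg_left (Finset.sum_le_sum fun x _ => ?_) (by positivity)
  have := hV x
  split_ifs with h1 h2
  · norm_num
  · exact absurd (this (not_le.1 h2)) (not_lt.2 h1)
  · norm_num
  · norm_num

/-- If no two samples at or above the price coincide, then the estimated total spend jumps by at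
most `p / n`, and hence exceeds the budget at the estimated multiplier by at most `p / n`. -/
lemma sum_approxMultiplier_le {E n T : ℕ} (hE : 0 < E) (hn : 0 < n) {B p : ℝ} (hB : 0 ≤ B)
    (hp : 0 < p) (V : Fin E → Fin n → ℝ)
    (hV : ∀ x y : Fin E × Fin n, x ≠ y → p ≤ V x.1 x.2 → V x.1 x.2 ≠ V y.1 y.2) :
    ∑ e, approxSpendFP (V e) p (approxMultiplier B T (fun e => approxSpendFP (V e) p))
      ≤ E * (B / T) + p / n := by
  set m := approxMultiplier B T (fun e => approxSpendFP (V e) p) with hm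
  have hm0 : 0 ≤ m := approxMultiplier_nonneg _ _ _
  -- Just right of `m`, only samples equal to the threshold at `m` drop out.
  have hev : ∀ᶠ μ in 𝓝[>] m, (∀ x : Fin E × Fin n, (1 + m) * p < V x.1 x.2 →
      (1 + μ) * p < V x.1 x.2) ∧ m < μ := by
    refine (eventually_all.2 fun x => ?_).and self_mem_nhdsWithin
    by_cases hx : (1 + m) * p < V x.1 x.2
    · filter_upwards [nhdsWithin_le_nhds ((tendsto_threshold p m).eventually_lt_const hx)]
        with μ h _ using h
    · exact Eventually.of_forall fun μ h => absurd h hx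
  obtain ⟨μ, hμ, hlt⟩ := hev.exists
  have hle := sum_le_of_approxMultiplier_lt hE hn hB hp V (hm ▸ hlt)
  have hone : ∑ x : Fin E × Fin n, (if V x.1 x.2 = (1 + m) * p then (1 : ℝ) else 0) ≤ 1 := by
    rw [Finset.sum_boole]
    have : (Finset.univ.filter fun x : Fin E × Fin n => V x.1 x.2 = (1 + m) * p).card ≤ 1 := by
      refine Finset.card_le_one.2 fun x hx y hy => ?_
      simp only [Finset.mem_filter, Finset.mem_univ, true_and] at hx hy
      by_contra hxy
      -- The threshold is at least `p` because `0 ≤ m`, so the no-ties hypothesis applies.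
      exact hV x y hxy (by rw [hx]; nlinarith) (hx.trans hy.symm)
    exact_mod_cast this
  have hsum : ∑ x : Fin E × Fin n, (if (1 + m) * p ≤ V x.1 x.2 then (1 : ℝ) else 0)
      ≤ ∑ x : Fin E × Fin n, (if (1 + μ) * p ≤ V x.1 x.2 then (1 : ℝ) else 0) + 1 := by
    refine le_trans ?_ (add_le_add_right hone _)
    rw [← Finset.sum_add_distrib]
    refine Finset.sum_le_sum fun x _ => ?_
    rcases lt_trichotomy ((1 + m) * p) (V x.1 x.2) with h | h | h
    · rw [if_pos (hμ x h).le]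
      split_ifs <;> norm_num
    · rw [if_pos h.symm]
      split_ifs <;> norm_num
    · rw [if_neg (not_le.2 h)]
      split_ifs <;> norm_num
  rw [sum_approxSpendFP_eq hn] at hle ⊢
  have := mul_le_mul_of_nonneg_left hsum (by positivity : 0 ≤ p / n)
  linarith

/-- Pointwise accuracy at the optimal multiplier transfers to the computed spend rates. -/
lemma abs_approxSpendRate_sub_le {E n T : ℕ} (hE : 0 < E) (hn : 0 < n) {B p ε μ : ℝ} (hB : 0 ≤ B)
    (hp : 0 < p) (hε : 1 / (n : ℝ) ≤ 2 * ε) (V : Fin E → Fin n → ℝ)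
    (hV : ∀ x y : Fin E × Fin n, x ≠ y → p ≤ V x.1 x.2 → V x.1 x.2 ≠ V y.1 y.2)
    (g : Fin E → ℝ) (hμ : 0 ≤ μ) (hg : ∀ e, |approxSpendFP (V e) p μ - g e| ≤ p * ε)
    (hle : ∑ e, g e ≤ E * (B / T)) (hge : 0 < μ → E * (B / T) ≤ ∑ e, g e) (e : Fin E) :
    |approxSpendRate B T (fun e => approxSpendFP (V e) p) e - g e| ≤ (E + 1) * p * ε := by
  have hn' : (0 : ℝ) < n := by exact_mod_cast hn
  have hε0 : 0 ≤ ε := by have : 0 < 1 / (n : ℝ) := by positivity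
                         linarith
  have hpn : p / n ≤ 2 * (p * ε) := by
    have := mul_le_mul_of_nonneg_left hε hp.le
    rw [mul_one_div] at this
    linarith
  have hpε : 0 ≤ p * ε := by positivity
  have hEp : 0 ≤ (E : ℝ) * (p * ε) := by positivity
  have hsplit : ∀ a : Fin E → ℝ, ∑ e', a e' = a e + ∑ e' ∈ Finset.univ.erase e, a e' := fun a =>
    (Finset.add_sum_erase _ a (Finset.mem_univ e)).symm
  have hcard : ((Finset.univ.erase e).card : ℝ) = E - 1 := by
    rw [Finset.card_erase_of_mem (Finset.mem_univ e), Finset.card_univ, Fintype.card_fin,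
      Nat.cast_sub hE, Nat.cast_one]
  have hlow : ∑ e' ∈ Finset.univ.erase e, g e' - (E - 1) * (p * ε)
      ≤ ∑ e' ∈ Finset.univ.erase e, approxSpendFP (V e') p μ := by
    rw [← hcard, ← nsmul_eq_mul, ← Finset.sum_const, ← Finset.sum_sub_distrib]
    exact Finset.sum_le_sum fun e' _ => by have := abs_le.1 (hg e'); linarith
  have hupp : ∑ e' ∈ Finset.univ.erase e, approxSpendFP (V e') p μ
      ≤ ∑ e' ∈ Finset.univ.erase e, g e' + (E - 1) * (p * ε) := by
    rw [← hcard, ← nsmul_eq_mul, ← Finset.sum_const, ← Finset.sum_add_distrib]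
    exact Finset.sum_le_sum fun e' _ => by have := abs_le.1 (hg e'); linarith
  have hge' := abs_le.1 (hg e)
  have hjump := sum_approxMultiplier_le (T := T) hE hn hB hp V hV
  have hexh := le_sum_approxMultiplier (T := T) (B := B) hE hn hp V
  have hm0 := approxMultiplier_nonneg B T fun e => approxSpendFP (V e) p
  rw [approxSpendRate]
  set m := approxMultiplier B T (fun e => approxSpendFP (V e) p)
  have hanti : ∀ e', Antitone (approxSpendFP (V e') p) := fun e' =>
    antitone_approxSpendFP hn _ hp.le
  rw [hsplit] at hle hge hjump hexh
  rw [abs_le]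
  -- One side follows from monotonicity in episode `e` itself; the other by subtracting the
  -- remaining episodes from the total. Each strict case makes the larger multiplier positive, which
  -- activates its budget-exhaustion bound.
  rcases lt_trichotomy m μ with h | h | h
  · have h1 := hanti e h.le
    have h2 : ∑ e' ∈ Finset.univ.erase e, approxSpendFP (V e') p μ
      ≤ ∑ e' ∈ Finset.univ.erase e, approxSpendFP (V e') p m :=
      Finset.sum_le_sum fun e' _ => hanti e' h.le
    have h3 := hge (hm0.trans_lt h)
    constructor <;> linarith
  · rw [h]
    constructor <;> linarith
  · have h1 := hanti e h.le
    have h2 : ∑ e' ∈ Finset.univ.erase e, approxSpendFP (V e') p m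
      ≤ ∑ e' ∈ Finset.univ.erase e, approxSpendFP (V e') p μ :=
      Finset.sum_le_sum fun e' _ => hanti e' h.le
    have h3 := hexh (hμ.trans_lt h)
    constructor <;> linarith

end Deterministic

/-! ### First-order conditions for the expected dual. -/

section Dual

lemma spendFn_dirac (F : Measure ℝ) [IsProbabilityMeasure F] (p μ : ℝ) :
    spendFn F (Measure.dirac p) μ = p * F.real (Set.Ici ((1 + μ) * p)) := by
  have hm : Measurable fun z : ℝ × ℝ => if (1 + μ) * z.2 ≤ z.1 then z.2 else 0 :=
    Measurable.ite (measurableSet_le (by fun_prop) (by fun_prop)) (by fun_prop) (by fun_prop)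
  rw [spendFn, Measure.prod_dirac, integral_map (by fun_prop) hm.aestronglyMeasurable]
  have : (fun v : ℝ => if (1 + μ) * p ≤ v then p else 0)
      = (Set.Ici ((1 + μ) * p)).indicator fun _ => p := by
    ext v; simp [Set.indicator_apply]
  simp only [this]
  rw [integral_indicator_const _ measurableSet_Ici, smul_eq_mul, mul_comm]

lemma integrable_surplus {F : Measure ℝ} [IsProbabilityMeasure F] {h : ℝ}
    (hF : ∀ᵐ v ∂F, v ∈ Set.Icc 0 h) (c : ℝ) : Integrable (fun v => max (v - c) 0) F := by
  refine Integrable.of_mem_Icc 0 (max (h - c) 0) (by fun_prop) ?_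
  filter_upwards [hF] with v hv
  exact ⟨le_max_right _ _, max_le_max_right _ (by linarith [hv.2])⟩

lemma sum_divNat {E τ : ℕ} (f : Fin E → ℝ) :
    ∑ t : Fin (E * τ), f t.divNat = τ * ∑ e, f e := by
  rw [← finProdFinEquiv.sum_comp, Fintype.sum_prod_type, Finset.mul_sum]
  refine Finset.sum_congr rfl fun e _ => ?_
  have : ∀ j : Fin τ, (finProdFinEquiv (e, j)).divNat = e := fun j =>
    congrArg Prod.fst (finProdFinEquiv.symm_apply_apply (e, j))
  simp [this]

lemma dual_dirac {E τ : ℕ} {F : Fin E → Measure ℝ} [∀ e, IsProbabilityMeasure (F e)] {h : ℝ}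
    (hF : ∀ e, ∀ᵐ v ∂(F e), v ∈ Set.Icc 0 h) (B p μ : ℝ) :
    dual B F (fun _ => Measure.dirac p) τ μ
      = τ * ∑ e, ∫ v, max (v - (1 + μ) * p) 0 ∂(F e) + μ * B := by
  have hm : Measurable fun z : ℝ × ℝ => max (z.1 - (1 + μ) * z.2) 0 := by fun_prop
  have hi : ∀ e, Integrable (fun z : ℝ × ℝ => max (z.1 - (1 + μ) * z.2) 0)
      ((F e).prod (Measure.dirac p)) := by
    intro e
    rw [Measure.prod_dirac, integrable_map_measure hm.aestronglyMeasurable (by fun_prop)]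
    exact integrable_surplus (hF e) ((1 + μ) * p)
  have hv : ∀ e, ∫ z : ℝ × ℝ, max (z.1 - (1 + μ) * z.2) 0 ∂((F e).prod (Measure.dirac p))
      = ∫ v, max (v - (1 + μ) * p) 0 ∂(F e) := by
    intro e
    rw [Measure.prod_dirac, integral_map (by fun_prop) hm.aestronglyMeasurable]
  have hi' : ∀ t : Fin (E * τ), Integrable
      (fun w : Fin (E * τ) → ℝ × ℝ => max ((w t).1 - (1 + μ) * (w t).2) 0)
      (Measure.pi fun t : Fin (E * τ) => (F t.divNat).prod (Measure.dirac p)) := fun t =>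
    integrable_comp_eval (μ := fun t : Fin (E * τ) => (F t.divNat).prod (Measure.dirac p))
      (hi t.divNat)
  rw [dual, campaignLaw, integral_add (integrable_finsetSum _ fun t _ => hi' t)
    (integrable_const _), integral_finsetSum _ fun t _ => hi' t, ← sum_divNat]
  congr 1
  · refine Finset.sum_congr rfl fun t _ => ?_
    rw [← hv]
    exact integral_comp_eval (μ := fun t : Fin (E * τ) => (F t.divNat).prod (Measure.dirac p))
      hm.aestronglyMeasurable
  · simp

/-- The chord of the expected surplus between thresholds `a ≤ b` has slope between the tail
probabilities at `b` and at `a`. -/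
lemma surplus_sub_mem {F : Measure ℝ} [IsProbabilityMeasure F] {h : ℝ}
    (hF : ∀ᵐ v ∂F, v ∈ Set.Icc 0 h) {a b : ℝ} (hab : a ≤ b) :
    ∫ v, max (v - a) 0 ∂F - ∫ v, max (v - b) 0 ∂F
      ∈ Set.Icc ((b - a) * F.real (Set.Ici b)) ((b - a) * F.real (Set.Ici a)) := by
  have hind : ∀ c : ℝ, (b - a) * F.real (Set.Ici c)
      = ∫ v, (Set.Ici c).indicator (fun _ => b - a) v ∂F := fun c => by
    rw [integral_indicator_const _ measurableSet_Ici, smul_eq_mul, mul_comm]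
  have hint : ∀ c : ℝ, Integrable ((Set.Ici c).indicator fun _ : ℝ => b - a) F := fun c =>
    (integrable_const _).indicator measurableSet_Ici
  rw [hind, hind, ← integral_sub (integrable_surplus hF a) (integrable_surplus hF b)]
  have hs := (integrable_surplus hF a).sub (integrable_surplus hF b)
  constructor
  · refine integral_mono (hint b) hs fun v => ?_
    simp only [Set.indicator_apply, Set.mem_Ici]
    rcases max_cases (v - a) 0 with h1 | h1 <;> rcases max_cases (v - b) 0 with h2 | h2 <;>
      split_ifs <;> linarith
  · refine integral_mono hs (hint a) fun v => ?_
    simp only [Set.indicator_apply, Set.mem_Ici]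
    rcases max_cases (v - a) 0 with h1 | h1 <;> rcases max_cases (v - b) 0 with h2 | h2 <;>
      split_ifs <;> linarith

/-- Dominated convergence: as `y → x`, the indicator of `Ici y` converges at every point except `x`,
which is null. -/
lemma continuousAt_tail (F : Measure ℝ) [IsProbabilityMeasure F] {x : ℝ} (hx : F {x} = 0) :
    ContinuousAt (fun y => F.real (Set.Ici y)) x := by
  have h : (fun y => F.real (Set.Ici y)) =
      fun y => ∫ v, (Set.Ici y).indicator (fun _ => (1 : ℝ)) v ∂F := by
    ext y
    rw [integral_indicator_const _ measurableSet_Ici, smul_eq_mul, mul_one]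
  rw [h]
  refine continuousAt_of_dominated (bound := fun _ => 1)
    (Eventually.of_forall fun y =>
      (measurable_const.indicator measurableSet_Ici).aestronglyMeasurable)
    (Eventually.of_forall fun y => Eventually.of_forall fun v => ?_) (integrable_const _) ?_
  · exact (norm_indicator_le_norm_self _ _).trans (by simp)
  · have hne : ∀ᵐ v ∂F, v ≠ x := by
      rw [ae_iff]
      simpa using hx
    filter_upwards [hne] with v hv
    rcases lt_or_gt_of_ne hv with h | h
    · refine (continuousAt_const (y := (0 : ℝ))).congr ?_
      filter_upwards [lt_mem_nhds h] with y hy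
      simp [hy]
    · refine (continuousAt_const (y := (1 : ℝ))).congr ?_
      filter_upwards [gt_mem_nhds h] with y hy
      simp [hy.le]

/-- First-order conditions for a minimizer of the expected dual: the optimal spend is within the
budget, and exhausts it if the multiplier is positive. -/
lemma IsDualMinimizer.sum_spendFn {E τ : ℕ} (hE : 0 < E) (hτ : 0 < τ) {B p h : ℝ} (hp : 0 < p)
    {F : Fin E → Measure ℝ} [∀ e, IsProbabilityMeasure (F e)]
    (hF : ∀ e, ∀ᵐ v ∂(F e), v ∈ Set.Icc 0 h) (hF_atom : ∀ e, ∀ x, p ≤ x → F e {x} = 0) {μ : ℝ}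
    (hμ : IsDualMinimizer B F (fun _ => Measure.dirac p) τ μ) :
    ∑ e, spendFn (F e) (Measure.dirac p) μ ≤ E * (B / (E * τ : ℕ)) ∧
      (0 < μ → E * (B / (E * τ : ℕ)) ≤ ∑ e, spendFn (F e) (Measure.dirac p) μ) := by
  have hE' : (0 : ℝ) < E := by exact_mod_cast hE
  have hτ' : (0 : ℝ) < τ := by exact_mod_cast hτ
  obtain ⟨h0, hmin⟩ := hμ
  have hB : (E : ℝ) * (B / (E * τ : ℕ)) = B / τ := by
    push_cast
    field_simp
  rw [hB, le_div_iff₀' hτ', div_le_iff₀' hτ']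
  simp only [spendFn_dirac]
  set S : ℝ → ℝ := fun m => τ * ∑ e, p * (F e).real (Set.Ici ((1 + m) * p)) with hS
  have hcont : ContinuousAt S μ := by
    refine continuousAt_const.mul (tendsto_finsetSum _ fun e _ => ?_)
    refine tendsto_const_nhds.mul ?_
    exact (continuousAt_tail (F e) (hF_atom e ((1 + μ) * p) (by nlinarith))).tendsto.comp
      (tendsto_threshold p μ)
  have hchord : ∀ a b, a ≤ b →
      dual B F (fun _ => Measure.dirac p) τ a - dual B F (fun _ => Measure.dirac p) τ b
        ∈ Set.Icc ((b - a) * (S b - B)) ((b - a) * (S a - B)) := by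
    intro a b hab
    have hc := fun e => surplus_sub_mem (hF e)
      (by gcongr : (1 + a) * p ≤ (1 + b) * p)
    rw [dual_dirac hF, dual_dirac hF]
    have hlow := mul_le_mul_of_nonneg_left
      (Finset.sum_le_sum fun e (_ : e ∈ Finset.univ) => (hc e).1) hτ'.le
    have hupp := mul_le_mul_of_nonneg_left
      (Finset.sum_le_sum fun e (_ : e ∈ Finset.univ) => (hc e).2) hτ'.le
    have hr : ∀ m, τ * ∑ e, ((1 + b) * p - (1 + a) * p) * (F e).real (Set.Ici ((1 + m) * p))
        = (b - a) * S m := by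
      intro m
      simp only [hS, Finset.mul_sum]
      exact Finset.sum_congr rfl fun e _ => by ring
    rw [hr, Finset.sum_sub_distrib] at hlow hupp
    constructor <;> linarith
  constructor
  -- Minimality against `b > μ` forces `S b ≤ B`; letting `b` decrease to `μ` avoids differentiating
  -- the dual.
  · refine le_of_tendsto (hcont.tendsto.mono_left (nhdsWithin_le_nhds (s := Set.Ioi μ))) ?_
    filter_upwards [self_mem_nhdsWithin] with b hb
    have h1 := (hchord μ b (le_of_lt hb)).1
    have h2 : dual B F (fun _ => Measure.dirac p) τ μ ≤ _ := hmin (h0.trans (le_of_lt hb))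
    have h3 : 0 < b - μ := sub_pos.2 hb
    by_contra! h4
    have := mul_pos h3 (sub_pos.2 h4)
    linarith
  · intro hpos
    refine ge_of_tendsto (hcont.tendsto.mono_left (nhdsWithin_le_nhds (s := Set.Iio μ))) ?_
    -- Positivity of `μ` is what makes competitors `a < μ` feasible.
    filter_upwards [self_mem_nhdsWithin, nhdsWithin_le_nhds (lt_mem_nhds hpos)] with a ha ha0
    have h1 := (hchord a μ (le_of_lt ha)).2
    have h2 : dual B F (fun _ => Measure.dirac p) τ μ ≤ _ := hmin (le_of_lt ha0 : (0 : ℝ) ≤ a)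
    have h3 : 0 < μ - a := sub_pos.2 ha
    by_contra! h4
    have := mul_pos h3 (sub_pos.2 h4)
    nlinarith

end Dual

/-! ### Independence, absence of ties and concentration of the samples. -/

section Sampling

instance isProbabilityMeasure_sampleLaw {E n : ℕ} (F : Fin E → Measure ℝ)
    [∀ e, IsProbabilityMeasure (F e)] : IsProbabilityMeasure (sampleLaw F n) := by
  unfold sampleLaw
  infer_instance

lemma measurePreserving_episode {E n : ℕ} (F : Fin E → Measure ℝ)
    [∀ e, IsProbabilityMeasure (F e)] (e : Fin E) :
    MeasurePreserving (fun V : Fin E → Fin n → ℝ => V e) (sampleLaw F n)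
      (Measure.pi fun _ => F e) :=
  measurePreserving_eval (fun e => Measure.pi fun _ : Fin n => F e) e

lemma measurePreserving_sample {E n : ℕ} (F : Fin E → Measure ℝ)
    [∀ e, IsProbabilityMeasure (F e)] (e : Fin E) (i : Fin n) :
    MeasurePreserving (fun V : Fin E → Fin n → ℝ => V e i) (sampleLaw F n) (F e) :=
  (measurePreserving_eval (fun _ : Fin n => F e) i).comp (measurePreserving_episode F e)

lemma indepFun_sample {E n : ℕ} (F : Fin E → Measure ℝ) [∀ e, IsProbabilityMeasure (F e)]
    {x y : Fin E × Fin n} (hxy : x ≠ y) :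
    IndepFun (fun V : Fin E → Fin n → ℝ => V x.1 x.2) (fun V => V y.1 y.2) (sampleLaw F n) := by
  obtain ⟨e, i⟩ := x
  obtain ⟨e', j⟩ := y
  by_cases he : e = e'
  · subst he
    have hij : i ≠ j := fun h => hxy (by rw [h])
    have h : IndepFun (fun W : Fin n → ℝ => W i) (fun W => W j) (Measure.pi fun _ => F e) :=
      (iIndepFun_pi (X := fun _ : Fin n => id) fun _ => aemeasurable_id).indepFun hij
    have hmp := measurePreserving_episode (n := n) F e
    rw [← hmp.map_eq] at h
    rw [indepFun_iff_map_prod_eq_prod_map_map (measurable_pi_apply i).aemeasurable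
      (measurable_pi_apply j).aemeasurable] at h
    rw [Measure.map_map (by fun_prop) (by fun_prop), Measure.map_map (by fun_prop) (by fun_prop),
      Measure.map_map (by fun_prop) (by fun_prop)] at h
    exact (indepFun_iff_map_prod_eq_prod_map_map (μ := sampleLaw F n)
      (measurePreserving_sample F e i).aemeasurable
      (measurePreserving_sample F e j).aemeasurable).2 h
  · have h := (iIndepFun_pi (μ := fun e => Measure.pi fun _ : Fin n => F e)
      (X := fun _ => id) fun _ => aemeasurable_id).indepFun he
    exact h.comp (measurable_pi_apply i) (measurable_pi_apply j)

/-- Almost surely no two samples that are at least `p` coincide. -/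
lemma ae_sample_ne {E n : ℕ} (F : Fin E → Measure ℝ) [∀ e, IsProbabilityMeasure (F e)] {p : ℝ}
    (hF_atom : ∀ e, ∀ x, p ≤ x → F e {x} = 0) :
    ∀ᵐ V ∂(sampleLaw F n), ∀ x y : Fin E × Fin n, x ≠ y → p ≤ V x.1 x.2 →
      V x.1 x.2 ≠ V y.1 y.2 := by
  refine ae_all_iff.2 fun x => ae_all_iff.2 fun y => ?_
  by_cases hxy : x = y
  · simp [hxy]
  have hmx := measurePreserving_sample F x.1 x.2
  have hmy := measurePreserving_sample F y.1 y.2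
  have hmap : (sampleLaw F n).map (fun V => (V x.1 x.2, V y.1 y.2)) = (F x.1).prod (F y.1) := by
    rw [(indepFun_sample F hxy).map_prod_eq_prod_map_map hmx.aemeasurable hmy.aemeasurable,
      hmx.map_eq, hmy.map_eq]
  have hae : ∀ᵐ z ∂((F x.1).prod (F y.1)), ¬(p ≤ z.1 ∧ z.1 = z.2) := by
    have hms : MeasurableSet {z : ℝ × ℝ | ¬(p ≤ z.1 ∧ z.1 = z.2)} :=
      ((measurableSet_le measurable_const measurable_fst).inter
        (measurableSet_eq_fun measurable_fst measurable_snd)).compl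
    refine (Measure.ae_prod_iff_ae_ae hms).2 (Eventually.of_forall fun a => ?_)
    by_cases ha : p ≤ a
    -- The exceptional fibre over `a` is the singleton `{a}`.
    · rw [ae_iff]
      simpa [ha, eq_comm, Set.ofPred_eq_eq_singleton] using hF_atom y.1 a ha
    · simp [ha]
  rw [← hmap] at hae
  filter_upwards [ae_of_ae_map (hmx.aemeasurable.prodMk hmy.aemeasurable) hae] with V hV _ h1 h2
  exact hV ⟨h1, h2⟩

/-- Hoeffding's inequality for the empirical tail frequency at a fixed threshold. -/
lemma measureReal_le_abs_tail_sub {n : ℕ} (hn : 0 < n) (F : Measure ℝ) [IsProbabilityMeasure F]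
    (x : ℝ) {ε : ℝ} (hε : 0 ≤ ε) :
    (Measure.pi fun _ : Fin n => F).real
      {W | n * ε ≤ |∑ i, ((if x ≤ W i then (1 : ℝ) else 0) - F.real (Set.Ici x))|}
      ≤ 2 * Real.exp (-(2 * n * ε ^ 2)) := by
  have hn' : (0 : ℝ) < n := by exact_mod_cast hn
  set Y : ℝ → ℝ := fun v => (if x ≤ v then (1 : ℝ) else 0) - F.real (Set.Ici x) with hY
  have hYm : Measurable Y := by
    refine Measurable.sub_const (Measurable.ite measurableSet_Ici ?_ ?_) _ <;> fun_prop
  have hsub : HasSubgaussianMGF Y (1 / 4) F := by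
    have h := hasSubgaussianMGF_of_mem_Icc (μ := F) (a := 0) (b := 1)
      (X := (Set.Ici x).indicator fun _ => (1 : ℝ))
      (measurable_const.indicator measurableSet_Ici).aemeasurable
      (Eventually.of_forall fun v => by
        by_cases hv : x ≤ v <;> simp [hv])
    rw [integral_indicator_const _ measurableSet_Ici, smul_eq_mul, mul_one] at h
    have hc : (‖(1 : ℝ) - 0‖₊ / 2) ^ 2 = 1 / 4 := by
      rw [sub_zero, nnnorm_one]; norm_num
    rw [hc] at h
    exact h
  have hev : ∀ (Z : ℝ → ℝ), HasSubgaussianMGF Z (1 / 4) F → Measurable Z →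
      (Measure.pi fun _ : Fin n => F).real {W | n * ε ≤ ∑ i, Z (W i)}
        ≤ Real.exp (-(2 * n * ε ^ 2)) := by
    intro Z hZ hZm
    have hi : iIndepFun (fun (i : Fin n) (W : Fin n → ℝ) => Z (W i))
        (Measure.pi fun _ : Fin n => F) := iIndepFun_pi fun _ => hZm.aemeasurable
    refine (HasSubgaussianMGF.measure_sum_ge_le_of_iIndepFun hi (s := Finset.univ)
      (c := fun _ => 1 / 4) (fun i _ => ?_) (by positivity : 0 ≤ n * ε)).trans (le_of_eq ?_)
    · refine HasSubgaussianMGF.of_map (X := Z) (Y := fun W : Fin n → ℝ => W i)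
        (measurable_pi_apply i).aemeasurable ?_
      rwa [(measurePreserving_eval (fun _ : Fin n => F) i).map_eq]
    -- With variance proxy `1 / 4` per sample, the exponent is `(n ε)² / (2 * (n / 4)) = 2 n ε²`.
    · congr 1
      simp
      field_simp
      ring
  have h1 := hev Y hsub hYm
  have h2 := hev (-Y) hsub.neg hYm.neg
  have hss : {W : Fin n → ℝ | n * ε ≤ |∑ i, Y (W i)|}
      ⊆ {W | n * ε ≤ ∑ i, Y (W i)} ∪ {W | n * ε ≤ ∑ i, (-Y) (W i)} := by
    intro W hW
    rcases le_abs.1 (show n * ε ≤ |∑ i, Y (W i)| from hW) with h | h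
    · exact Or.inl h
    · right
      simpa using h
  calc _ ≤ _ := measureReal_mono hss
    _ ≤ _ := measureReal_union_le _ _
    _ ≤ _ := by linarith

/-- With high probability all estimated spends are accurate at a given multiplier. -/
lemma measureReal_exists_lt_abs_approxSpendFP_sub {E n : ℕ} (hn : 0 < n) (F : Fin E → Measure ℝ)
    [∀ e, IsProbabilityMeasure (F e)] {p : ℝ} (hp : 0 ≤ p) (μ : ℝ) {ε : ℝ} (hε : 0 ≤ ε) :
    (sampleLaw F n).real {V | ∃ e, p * ε <
        |approxSpendFP (V e) p μ - p * (F e).real (Set.Ici ((1 + μ) * p))|}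
      ≤ E * (2 * Real.exp (-(2 * n * ε ^ 2))) := by
  have hn' : (0 : ℝ) < n := by exact_mod_cast hn
  set A : Fin E → Set (Fin n → ℝ) := fun e => {W | n * ε ≤
    |∑ i, ((if (1 + μ) * p ≤ W i then (1 : ℝ) else 0) - (F e).real (Set.Ici ((1 + μ) * p)))|}
    with hA
  have hAm : ∀ e, MeasurableSet (A e) := by
    intro e
    refine measurableSet_le measurable_const ?_
    have hm : ∀ i : Fin n, Measurable fun W : Fin n → ℝ =>
        if (1 + μ) * p ≤ W i then (1 : ℝ) else 0 := fun i =>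
      Measurable.ite (measurableSet_le measurable_const (measurable_pi_apply i))
        measurable_const measurable_const
    exact (Finset.measurable_fun_sum _ fun i _ => (hm i).sub_const _).norm
  have hss : {V : Fin E → Fin n → ℝ | ∃ e, p * ε <
        |approxSpendFP (V e) p μ - p * (F e).real (Set.Ici ((1 + μ) * p))|}
      ⊆ ⋃ e, (fun V : Fin E → Fin n → ℝ => V e) ⁻¹' A e := by
    rintro V ⟨e, he⟩
    refine Set.mem_iUnion.2 ⟨e, ?_⟩
    rw [approxSpendFP_eq hn] at he
    by_contra! hlt
    have hlt : |∑ i, ((if (1 + μ) * p ≤ V e i then (1 : ℝ) else 0)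
      - (F e).real (Set.Ici ((1 + μ) * p)))| < n * ε := not_le.1 hlt
    have heq : p / n * (∑ i, if (1 + μ) * p ≤ V e i then (1 : ℝ) else 0)
        - p * (F e).real (Set.Ici ((1 + μ) * p))
        = p / n * ∑ i, ((if (1 + μ) * p ≤ V e i then (1 : ℝ) else 0)
          - (F e).real (Set.Ici ((1 + μ) * p))) := by
      rw [Finset.sum_sub_distrib, Finset.sum_const, Finset.card_univ, Fintype.card_fin,
        nsmul_eq_mul]
      field_simp
    rw [heq, abs_mul, abs_of_nonneg (by positivity : 0 ≤ p / n)] at he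
    have := mul_le_mul_of_nonneg_left hlt.le (by positivity : 0 ≤ p / n)
    rw [← mul_assoc, div_mul_cancel₀ _ hn'.ne'] at this
    linarith
  calc _ ≤ _ := measureReal_mono hss
    _ ≤ ∑ e, (sampleLaw F n).real ((fun V : Fin E → Fin n → ℝ => V e) ⁻¹' A e) :=
      measureReal_iUnion_fintype_le _
    _ ≤ ∑ e : Fin E, 2 * Real.exp (-(2 * n * ε ^ 2)) := by
      refine Finset.sum_le_sum fun e _ => ?_
      rw [(measurePreserving_episode F e).measureReal_preimage (hAm e).nullMeasurableSet]
      exact measureReal_le_abs_tail_sub hn (F e) _ hε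
    _ = _ := by simp

end Sampling

end AdPacing

/-! ### Choice of `ε` and assembly. -/

open AdPacing in
theorem mainTheorem3
    (E τ n : ℕ) (hE : 0 < E) (hτ : 0 < τ) (hn : 0 < n)
    (B p h δ : ℝ) (hB : 0 ≤ B) (hp : 0 ≤ p) (hδ₀ : 0 < δ) (hδ₁ : δ < 1)
    (F : Fin E → MeasureTheory.Measure ℝ)
    [∀ e, MeasureTheory.IsProbabilityMeasure (F e)]
    (hF : ∀ e, ∀ᵐ v ∂(F e), v ∈ Set.Icc 0 h)
    (hF_atom : ∀ e, ∀ x, p ≤ x → F e {x} = 0)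
    (ρ : Fin E → ℝ)
    (hρ : AdPacing.IsOptimalSpendRates B F (fun _ => MeasureTheory.Measure.dirac p) τ ρ) :
    1 - δ ≤ (AdPacing.sampleLaw F n).real
      {V | ∀ e, |AdPacing.approxSpendRate B (E * τ)
                    (fun e' => AdPacing.approxSpendFP (V e') p) e - ρ e|
          ≤ ((E : ℝ) + 1) * p * √(Real.log (2 * (E : ℝ) / δ) / (2 * (n : ℝ)))} := by
  obtain ⟨μ, hμ, hρμ⟩ := hρ
  -- At price zero all spends vanish.
  rcases hp.eq_or_lt with rfl | hp
  · have huniv : {V : Fin E → Fin n → ℝ | ∀ e, |approxSpendRate B (E * τ)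
        (fun e' => approxSpendFP (V e') 0) e - ρ e|
          ≤ ((E : ℝ) + 1) * 0 * √(Real.log (2 * (E : ℝ) / δ) / (2 * (n : ℝ)))} = Set.univ := by
      ext V
      simp [hρμ, spendFn_dirac, approxSpendRate, approxSpendFP]
    rw [huniv, probReal_univ]
    linarith
  have hE' : (1 : ℝ) ≤ E := by exact_mod_cast hE
  have hn' : (1 : ℝ) ≤ n := by exact_mod_cast hn
  set ε := √(Real.log (2 * (E : ℝ) / δ) / (2 * (n : ℝ))) with hε
  have hratio : 2 ≤ 2 * (E : ℝ) / δ := by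
    rw [le_div_iff₀ hδ₀]
    nlinarith
  -- This bound is what yields `1 / n ≤ 2 * ε`: squared, that inequality reads `1 ≤ 2 * n * log (2 *
  -- E / δ)`.
  have hlog : 1 / 2 ≤ Real.log (2 * (E : ℝ) / δ) :=
    (by linarith [Real.log_two_gt_d9] : (1 : ℝ) / 2 ≤ Real.log 2).trans
      (Real.log_le_log two_pos hratio)
  have hsq : ε ^ 2 = Real.log (2 * (E : ℝ) / δ) / (2 * (n : ℝ)) :=
    Real.sq_sqrt (by positivity)
  have hexp : E * (2 * Real.exp (-(2 * n * ε ^ 2))) = δ := by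
    rw [hsq, mul_div_cancel₀ _ (by positivity), Real.exp_neg, Real.exp_log (by positivity)]
    field_simp
  have hnε : 1 / (n : ℝ) ≤ 2 * ε := by
    refine abs_le_of_sq_le_sq' ?_ (by positivity) |>.2
    rw [mul_pow, hsq, div_pow, one_pow, div_le_iff₀ (by positivity)]
    have : 2 ^ 2 * (Real.log (2 * (E : ℝ) / δ) / (2 * (n : ℝ))) * (n : ℝ) ^ 2
        = 2 * Real.log (2 * (E : ℝ) / δ) * n := by
      field_simp
    rw [this]
    nlinarith
  obtain ⟨hle, hge⟩ := hμ.sum_spendFn hE hτ hp hF hF_atom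
  simp only [← hρμ] at hle hge
  set bad := {V : Fin E → Fin n → ℝ | ∃ e, p * ε <
    |approxSpendFP (V e) p μ - p * (F e).real (Set.Ici ((1 + μ) * p))|}
  have hbad : (sampleLaw F n).real bad ≤ δ :=
    (measureReal_exists_lt_abs_approxSpendFP_sub hn F hp.le μ (Real.sqrt_nonneg _)).trans hexp.le
  have hties := ae_iff.1 (ae_sample_ne (n := n) F hF_atom)
  set ties := {V : Fin E → Fin n → ℝ | ¬∀ x y : Fin E × Fin n, x ≠ y → p ≤ V x.1 x.2 →
      V x.1 x.2 ≠ V y.1 y.2}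
  have hties' : (sampleLaw F n).real ties = 0 := by rw [Measure.real, hties, ENNReal.toReal_zero]
  set good := {V : Fin E → Fin n → ℝ | ∀ e, |approxSpendRate B (E * τ)
    (fun e' => approxSpendFP (V e') p) e - ρ e| ≤ ((E : ℝ) + 1) * p * ε}
  -- Covering the whole space and using subadditivity avoids proving `good` measurable.
  have hcover : Set.univ ⊆ good ∪ (bad ∪ ties) := by
    intro V _
    by_cases h1 : V ∈ bad
    · exact Or.inr (Or.inl h1)
    by_cases h2 : V ∈ ties
    · exact Or.inr (Or.inr h2)
    left
    intro e
    refine abs_approxSpendRate_sub_le hE hn hB hp hnε V (not_not.1 h2) ρ hμ.1 (fun e => ?_)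
      hle hge e
    rw [hρμ, spendFn_dirac]
    exact not_lt.1 fun h => h1 ⟨e, h⟩
  have h1 := measureReal_mono (μ := sampleLaw F n) hcover
  rw [probReal_univ] at h1
  have h2 := measureReal_union_le (μ := sampleLaw F n) good (bad ∪ ties)
  have h3 := measureReal_union_le (μ := sampleLaw F n) bad ties
  linarith
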